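/- Let $A$ be a one-dimensional Cohen–Macaulay (Noetherian) local ring with total quotient ring $\mathrm{Q}(A)$, and let $A\subseteq C\subseteq \mathrm{Q}(A)$ be an intermediate ring that is finitely generated as an $A$-module. Assume that $\mathrm{e}(C_{\mathcal M})\le 2$ for every maximal ideal $\mathcal M$ of $C$, where the multiplicity of a Noetherian local ring $(R,\mathfrak m)$ of dimension $d$ is $\mathrm{e}(R)=\lim_{n\to\infty} d!\,\ell_R(R/\mathfrak m^{n})/n^{d}$. Then: 1. For every intermediate ring $C\subseteq D\subseteq \mathrm{Q}(C)$ that is finitely generated as a $C$-module, $\mathrm{e}(D_{\mathcal N})\le 2$ for every maximal ideal $\mathcal N$ of $D$. 2. In particular, $C$ is an Arf ring. That is, $C$ is a Noetherian semi-local ring, $C_{\mathcal M}$ is a one-dimensional Cohen–Macaulay ring for every maximal ideal $\mathcal M$ of $C$, and every integrally closed ideal $I$ of $C$ that contains a non-zero-divisor on $C$ is stable, meaning that $$\bigcup_{n\ge 1}\bigl(I^n:_{\mathrm{Q}(C)}I^n\bigr)=I:_{\mathrm{Q}(C)}I,\qquad\text{where } I:_{\mathrm{Q}(C)}I=\{z\in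 \mathrm{Q}(C) : zI\subseteq I\}.$$ Here $I$ is integrally closed if it contains every $x\in C$ satisfying an equation $x^n+a_1x^{n-1}+\cdots+a_n=0$ with $n\ge 1$ and $a_i\in I^i$ for $1\le i\le n$. -/

import Mathlib

open Filter Topology
open scoped ENNReal nonZeroDivisors Nat

/-- A Noetherian local ring is Cohen–Macaulay if its maximal ideal contains a regular sequence
whose length is the Krull dimension of the ring. -/
def IsCohenMacaulayLocal (R : Type*) [CommRing R] [IsLocalRing R] : Prop :=
  IsNoetherianRing R ∧ ∃ rs : List R, (∀ r ∈ rs, r ∈ IsLocalRing.maximalIdeal R) ∧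
    RingTheory.Sequence.IsRegular R rs ∧ ringKrullDim R = (rs.length : ℕ)

/-- `HasMultiplicity R e`: the (Hilbert–Samuel) multiplicity of the local ring `(R, 𝔪)` of
dimension `d` exists and equals `e`, that is `e = lim d! ℓ(R / 𝔪 ^ n) / n ^ d`.
(The limit is taken in `[0, ∞]`, where lengths naturally live.) -/
def HasMultiplicity (R : Type*) [CommRing R] [IsLocalRing R] (e : ℝ≥0∞) : Prop :=
  ∃ d : ℕ, ringKrullDim R = d ∧
    Tendsto (fun n : ℕ ↦ (d ! : ℝ≥0∞) *
      (Module.length R (R ⧸ IsLocalRing.maximalIdeal R ^ n) : ℝ≥0∞) / (n : ℝ≥0∞) ^ d)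
      atTop (𝓝 e)

/-- `x` is integral over the ideal `I`: it satisfies an equation
`x ^ n + a₁ x ^ (n - 1) + ⋯ + aₙ = 0` with `n ≥ 1` and `aᵢ ∈ I ^ i`. -/
def IsIntegralOverIdeal {R : Type*} [CommRing R] (I : Ideal R) (x : R) : Prop :=
  ∃ n : ℕ, 1 ≤ n ∧ ∃ a : ℕ → R, (∀ i, a i ∈ I ^ i) ∧
    x ^ n + ∑ i ∈ Finset.Icc 1 n, a i * x ^ (n - i) = 0

/-- An ideal is integrally closed if it contains every element integral over it. -/
def IsIntegrallyClosedIdeal {R : Type*} [CommRing R] (I : Ideal R) : Prop :=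
  ∀ x : R, IsIntegralOverIdeal I x → x ∈ I

/-- The colon `I :_Q I = {z ∈ Q | z I ⊆ I}` in the total quotient ring `Q = Q(R)`. -/
noncomputable def endColon {R : Type*} [CommRing R] (I : Ideal R) :
    Submodule R (FractionRing R) :=
  IsLocalization.coeSubmodule (FractionRing R) I / IsLocalization.coeSubmodule (FractionRing R) I

/-- The blowup `R^I = ⋃_{n ≥ 1} (I ^ n :_Q I ^ n)` of `R` at `I`, a subset of `Q = Q(R)`. -/
def idealBlowup {R : Type*} [CommRing R] (I : Ideal R) : Set (FractionRing R) :=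
  {z | ∃ n : ℕ, 1 ≤ n ∧ z ∈ endColon (I ^ n)}

/-- An ideal `I` is stable if `R^I = I :_Q I`. -/
def IsStableIdeal {R : Type*} [CommRing R] (I : Ideal R) : Prop :=
  idealBlowup I = (endColon I : Set (FractionRing R))

/-- An Arf ring: a Noetherian semi-local ring, all of whose localizations at maximal ideals are
one-dimensional Cohen–Macaulay rings, such that every integrally closed ideal containing a
non-zero-divisor is stable. -/
structure IsArfRing (R : Type*) [CommRing R] : Prop where
  noetherian : IsNoetherianRing R
  semilocal : Finite (MaximalSpectrum R)
  dim_one : ∀ (M : Ideal R) [M.IsMaximal], ringKrullDim (Localization.AtPrime M) = 1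
  cohenMacaulay : ∀ (M : Ideal R) [M.IsMaximal], IsCohenMacaulayLocal (Localization.AtPrime M)
  stable : ∀ I : Ideal R, (∃ a ∈ I, a ∈ R⁰) → IsIntegrallyClosedIdeal I → IsStableIdeal I

/-! Localize `C` at a maximal ideal to get a one-dimensional Cohen–Macaulay local ring R with
multiplicity at most 2. The core is that every regular ideal I of R satisfies I² = cI for some c ∈ I
(`exists_sq_eq_span_singleton_mul`). Residue fields may be finite, so a reduction of 𝔪 itself need
not be principal. Instead, counting colengths yields r with 𝔪^r and 𝔪^(2r) both two-generated,
whence 𝔪^(2r) = y𝔪^r and ℓ(R/y) ≤ 2r. Comparing yI with 𝔪^r I then shows that every regular ideal is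
two-generated; applied to I and I², this gives c.

Stability follows: I^(n+1) = cⁿI locally, so cⁿ cancels from any containment pI^(n+1) ⊆ sI^(n+1).

For a finite birational extension `D`, a denominator s with sD ⊆ C bounds the Hilbert function at N
by the one at N ∩ C plus a constant (`colength_pow_le_colength_comap_pow_add`). The limit exists
because it is 1 when the maximal ideal is principal, and otherwise all increments are at least 2,
which forces the limit 2. -/

namespace Ideal

/-! ### Colength of regular ideals in dimension at most one. -/

variable {R : Type*} [CommRing R]

/-- An ideal is regular if it contains a non-zero-divisor. -/
def IsRegularIdeal (I : Ideal R) : Prop := ∃ a ∈ I, a ∈ R⁰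

/-- The length of `R ⧸ I` as a natural number (zero if the length is infinite). -/
noncomputable def colength (I : Ideal R) : ℕ := (Module.length R (R ⧸ I)).toNat

namespace IsRegularIdeal

lemma mono {I J : Ideal R} (hI : I.IsRegularIdeal) (h : I ≤ J) : J.IsRegularIdeal :=
  let ⟨a, ha, ha'⟩ := hI
  ⟨a, h ha, ha'⟩

lemma mul {I J : Ideal R} (hI : I.IsRegularIdeal) (hJ : J.IsRegularIdeal) :
    (I * J).IsRegularIdeal :=
  let ⟨a, ha, ha'⟩ := hI
  let ⟨b, hb, hb'⟩ := hJ
  ⟨a * b, Ideal.mul_mem_mul ha hb, mul_mem ha' hb'⟩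

lemma pow {I : Ideal R} (hI : I.IsRegularIdeal) (n : ℕ) : (I ^ n).IsRegularIdeal :=
  let ⟨a, ha, ha'⟩ := hI
  ⟨a ^ n, Ideal.pow_mem_pow ha n, pow_mem ha' n⟩

lemma span_singleton {a : R} (ha : a ∈ R⁰) : (Ideal.span {a}).IsRegularIdeal :=
  ⟨a, Ideal.mem_span_singleton_self a, ha⟩

lemma mem_nonZeroDivisors_of_le_span_singleton {I : Ideal R} (hI : I.IsRegularIdeal) {a : R}
    (h : I ≤ Ideal.span {a}) : a ∈ R⁰ := by
  obtain ⟨b, hb, hb'⟩ := hI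
  obtain ⟨c, rfl⟩ := Ideal.mem_span_singleton.1 (h hb)
  exact (mul_mem_nonZeroDivisors.1 hb').1

variable [IsNoetherianRing R] [Ring.KrullDimLE 1 R]

lemma length_ne_top {I : Ideal R} (hI : I.IsRegularIdeal) : Module.length R (R ⧸ I) ≠ ⊤ := by
  obtain ⟨a, ha, ha'⟩ := hI
  have h1 := Module.length_ne_top_iff.2 (isFiniteLength_quotient_span_singleton R ha')
  have hle : Ideal.span {a} ≤ I := (Ideal.span_singleton_le_iff_mem _).2 ha
  exact ne_top_of_le_ne_top h1
    (Module.length_le_of_surjective (Submodule.factor hle) (Submodule.factor_surjective hle))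

lemma coe_colength {I : Ideal R} (hI : I.IsRegularIdeal) :
    (I.colength : ℕ∞) = Module.length R (R ⧸ I) :=
  ENat.natCast_toNat hI.length_ne_top

lemma colength_lt {I J : Ideal R} (hI : I.IsRegularIdeal) (h : I < J) :
    J.colength < I.colength := by
  have hJ := hI.mono h.le
  rw [← Nat.cast_lt (α := ℕ∞), hI.coe_colength, hJ.coe_colength, Module.length_quotient,
    Module.length_quotient]
  refine Order.coheight_strictAnti h ?_
  rw [← Module.length_quotient]
  exact hJ.length_ne_top.lt_top

lemma colength_le {I J : Ideal R} (hI : I.IsRegularIdeal) (h : I ≤ J) :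
    J.colength ≤ I.colength := by
  rcases h.eq_or_lt with rfl | h
  · rfl
  · exact (hI.colength_lt h).le

/-- Length is additive along 0 → R/I → R/aI → R/a → 0, the first map being multiplication by a. -/
lemma colength_span_singleton_mul {I : Ideal R} (hI : I.IsRegularIdeal) {a : R} (ha : a ∈ R⁰) :
    (Ideal.span {a} * I).colength = (Ideal.span {a}).colength + I.colength := by
  have h := Module.length_eq_add_of_exact (Ideal.mulQuot a I) (Ideal.quotOfMul a I)
    (Ideal.mulQuot_injective I ha) (Ideal.quotOfMul_surjective I) (Ideal.exact_mulQuot_quotOfMul I)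
  rw [← Submodule.ideal_span_singleton_smul, smul_eq_mul, add_comm] at h
  have h1 := span_singleton ha
  rw [← (h1.mul hI).coe_colength, ← h1.coe_colength, ← hI.coe_colength] at h
  exact_mod_cast h

end IsRegularIdeal

lemma colength_top : (⊤ : Ideal R).colength = 0 := by
  have : Module.length R (R ⧸ (⊤ : Ideal R)) = 0 := Module.length_eq_zero
  rw [colength, this, ENat.toNat_zero]

variable [IsNoetherianRing R] [Ring.KrullDimLE 1 R]

lemma exists_eq_sup_span_singleton_of_colength_le {I J : Ideal R} (hI : I.IsRegularIdeal)
    (hle : I ≤ J) (h : I.colength ≤ J.colength + 1) : ∃ a ∈ J, J = I ⊔ Ideal.span {a} := by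
  rcases hle.eq_or_lt with rfl | hlt
  · exact ⟨0, zero_mem _, by simp⟩
  obtain ⟨a, haJ, haI⟩ := SetLike.exists_of_lt hlt
  refine ⟨a, haJ, ?_⟩
  have hle' : I ⊔ Ideal.span {a} ≤ J :=
    sup_le hle ((Ideal.span_singleton_le_iff_mem _).2 haJ)
  have hlt1 : I < I ⊔ Ideal.span {a} := by
    refine lt_of_le_of_ne le_sup_left fun h ↦ haI ?_
    rw [h]
    exact Ideal.mem_sup_right (Ideal.mem_span_singleton_self a)
  by_contra hne
  have h1 := hI.colength_lt hlt1
  have h2 := (hI.mono hlt1.le).colength_lt (lt_of_le_of_ne hle' (Ne.symm hne))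
  omega

lemma exists_eq_sup_span_pair_of_colength_le {I J : Ideal R} (hI : I.IsRegularIdeal)
    (hle : I ≤ J) (h : I.colength ≤ J.colength + 2) :
    ∃ a ∈ J, ∃ b ∈ J, J = I ⊔ Ideal.span {a, b} := by
  rcases hle.eq_or_lt with rfl | hlt
  · exact ⟨0, zero_mem _, 0, zero_mem _, by simp⟩
  obtain ⟨a, haJ, haI⟩ := SetLike.exists_of_lt hlt
  have hle' : I ⊔ Ideal.span {a} ≤ J :=
    sup_le hle ((Ideal.span_singleton_le_iff_mem _).2 haJ)
  have hlt1 : I < I ⊔ Ideal.span {a} := by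
    refine lt_of_le_of_ne le_sup_left fun h ↦ haI ?_
    rw [h]
    exact Ideal.mem_sup_right (Ideal.mem_span_singleton_self a)
  have h1 := hI.colength_lt hlt1
  obtain ⟨b, hbJ, hb⟩ :=
    exists_eq_sup_span_singleton_of_colength_le (hI.mono hlt1.le) hle' (by omega)
  exact ⟨a, haJ, b, hbJ, by rw [Ideal.span_insert, ← sup_assoc]; exact hb⟩

end Ideal

/-! ### Numbers of generators in local rings. -/

namespace IsLocalRing

open Ideal

variable {R : Type*} [CommRing R] [IsLocalRing R]

/-- In a local ring, an invertible ideal is principal. -/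
lemma eq_span_singleton_of_mul_eq_span_singleton {I J : Ideal R} {w : R} (hw : w ∈ R⁰)
    (h : I * J = Ideal.span {w}) : ∃ a ∈ I, I = Ideal.span {a} := by
  -- Otherwise IJ ⊆ w𝔪, so w = wc with c ∈ 𝔪, and cancelling w gives 1 ∈ 𝔪.
  have key : ∃ a ∈ I, ∃ b ∈ J, ∃ u : R, IsUnit u ∧ a * b = w * u := by
    by_contra! hcon
    have hle : I * J ≤ Ideal.span {w} * maximalIdeal R := by
      rw [Ideal.mul_le]
      intro a ha b hb
      obtain ⟨c, hc⟩ := Ideal.mem_span_singleton.1 (h ▸ Ideal.mul_mem_mul ha hb)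
      have hcm : c ∈ maximalIdeal R := by
        by_contra hcm
        exact hcon a ha b hb c (by simpa using hcm) hc
      rw [hc]
      exact Ideal.mul_mem_mul (Ideal.mem_span_singleton_self w) hcm
    rw [h] at hle
    obtain ⟨c, hc, hwc⟩ := Ideal.mem_span_singleton_mul.1 (hle (Ideal.mem_span_singleton_self w))
    have : c = 1 := by
      have : w * (c - 1) = 0 := by rw [mul_sub, hwc, mul_one, sub_self]
      have := (mem_nonZeroDivisors_iff.1 hw).1 _ this
      exact sub_eq_zero.1 this
    subst this
    exact (Ideal.ne_top_iff_one _).1 (maximalIdeal.isMaximal R).ne_top hc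
  obtain ⟨a, ha, b, hb, u, hu, hab⟩ := key
  refine ⟨a, ha, le_antisymm ?_ ((Ideal.span_singleton_le_iff_mem _).2 ha)⟩
  intro x hx
  obtain ⟨c, hc⟩ := Ideal.mem_span_singleton.1 (h ▸ Ideal.mul_mem_mul hx hb)
  have hb' : b ∈ R⁰ := by
    have : a * b ∈ R⁰ := hab ▸ mul_mem hw hu.mem_nonZeroDivisors
    exact (mul_mem_nonZeroDivisors.1 this).2
  obtain ⟨v, hv⟩ := hu.exists_right_inv
  rw [Ideal.mem_span_singleton]
  refine ⟨v * c, ?_⟩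
  have : b * (x - a * (v * c)) = 0 := by linear_combination hc - hab * v * c - w * c * hv
  have := (mem_nonZeroDivisors_iff.1 hb').1 _ this
  exact sub_eq_zero.1 this

variable [IsNoetherianRing R]

lemma le_of_le_sup_maximalIdeal_mul {I J : Ideal R} (h : J ≤ I ⊔ maximalIdeal R * J) : J ≤ I :=
  Submodule.le_of_le_smul_of_le_jacobson_bot (IsNoetherian.noetherian J)
    (by rw [jacobson_eq_maximalIdeal _ bot_ne_top]) h

variable [Ring.KrullDimLE 1 R]

/-- The difference of colengths is ℓ(I/𝔪I), the minimal number of generators by Nakayama. -/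
lemma exists_eq_span_singleton_of_colength_le (hm : (maximalIdeal R).IsRegularIdeal)
    {I : Ideal R} (hI : I.IsRegularIdeal) (h : (maximalIdeal R * I).colength ≤ I.colength + 1) : ∃ a ∈ I, I = Ideal.span {a} := by
  obtain ⟨a, ha, hIa⟩ :=
    exists_eq_sup_span_singleton_of_colength_le (hm.mul hI) Ideal.mul_le_right h
  refine ⟨a, ha, le_antisymm (le_of_le_sup_maximalIdeal_mul ?_)
    ((Ideal.span_singleton_le_iff_mem _).2 ha)⟩
  rw [sup_comm]
  exact hIa.le

lemma exists_eq_span_pair_of_colength_le (hm : (maximalIdeal R).IsRegularIdeal)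
    {I : Ideal R} (hI : I.IsRegularIdeal) (h : (maximalIdeal R * I).colength ≤ I.colength + 2) : ∃ a b, I = Ideal.span {a, b} := by
  obtain ⟨a, ha, b, hb, hIa⟩ :=
    exists_eq_sup_span_pair_of_colength_le (hm.mul hI) Ideal.mul_le_right h
  refine ⟨a, b, le_antisymm (le_of_le_sup_maximalIdeal_mul ?_) ?_⟩
  · rw [sup_comm]
    exact hIa.le
  · rw [Ideal.span_le]
    rintro x (rfl | rfl) <;> assumption

end IsLocalRing

/-! ### Principal reductions in multiplicity at most two. -/

/-- A sequence with `limsup a n / n ≤ 2`, in terms of natural numbers. -/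
def AsympLeTwo (a : ℕ → ℕ) : Prop := ∀ k : ℕ, ∀ᶠ n in atTop, k * a n ≤ (2 * k + 1) * n

namespace IsLocalRing

open Ideal

variable {R : Type*} [CommRing R] [IsLocalRing R] [IsNoetherianRing R] [Ring.KrullDimLE 1 R]

/-- By Nakayama it suffices to work in J²/𝔪J², of length at most 2 and generated by a², ab, b². If
ab vanishes there, c = a + b works, as ca = a² and cb = b². If a² is a multiple of ab, take c = b.
Otherwise ab and a² already generate, and c = a. -/
lemma exists_sq_eq_span_singleton_mul_of_colength_le (hm : (maximalIdeal R).IsRegularIdeal)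
    {J : Ideal R} (hJ : J.IsRegularIdeal) {a b : R} (hab : J = Ideal.span {a, b})
    (h : (maximalIdeal R * J ^ 2).colength ≤ (J ^ 2).colength + 2) :
    ∃ c ∈ J, J ^ 2 = Ideal.span {c} * J := by
  have haJ : a ∈ J := hab ▸ Ideal.subset_span (by simp)
  have hbJ : b ∈ J := hab ▸ Ideal.subset_span (by simp)
  set K := maximalIdeal R * J ^ 2 with hK
  have hKr : K.IsRegularIdeal := hm.mul (hJ.pow 2)
  have hKle : K ≤ J ^ 2 := Ideal.mul_le_right
  have hsq : ∀ I : Ideal R, a * a ∈ I → a * b ∈ I → b * b ∈ I → J ^ 2 ≤ I := by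
    intro I h1 h2 h3
    rw [sq, hab, Ideal.span_mul_span, Ideal.span_le]
    rintro _ ⟨x, rfl | rfl, y, rfl | rfl, rfl⟩
    exacts [h1, h2, (mul_comm y x ▸ h2 : x * y ∈ I), h3]
  have hmem : ∀ x ∈ J, ∀ y ∈ J, x * y ∈ J ^ 2 := fun x hx y hy ↦ sq J ▸ Ideal.mul_mem_mul hx hy
  have conclude : ∀ c ∈ J, J ^ 2 ≤ Ideal.span {c} * J ⊔ K →
      ∃ c ∈ J, J ^ 2 = Ideal.span {c} * J := by
    refine fun c hc hle ↦ ⟨c, hc, le_antisymm (le_of_le_sup_maximalIdeal_mul hle) ?_⟩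
    rw [sq]
    exact Ideal.mul_mono_left ((Ideal.span_singleton_le_iff_mem _).2 hc)
  have hmul : ∀ c, ∀ y ∈ J, c * y ∈ Ideal.span {c} * J ⊔ K := fun c y hy ↦
    Ideal.mem_sup_left (Ideal.mul_mem_mul (Ideal.mem_span_singleton_self c) hy)
  by_cases h1 : a * b ∈ K
  · refine conclude (a + b) (add_mem haJ hbJ) (hsq _ ?_ (Ideal.mem_sup_right h1) ?_)
    · have := sub_mem (hmul (a + b) a haJ) (Ideal.mem_sup_right h1)
      convert this using 1
      ring
    · have := sub_mem (hmul (a + b) b hbJ) (Ideal.mem_sup_right h1)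
      convert this using 1
      ring
  by_cases h2 : a * a ∈ K ⊔ Ideal.span {a * b}
  · refine conclude b hbJ (hsq _ ?_ ?_ (hmul b b hbJ))
    · refine (sup_le le_sup_right ?_ : K ⊔ Ideal.span {a * b} ≤ _) h2
      rw [Ideal.span_singleton_le_iff_mem, mul_comm a b]
      exact hmul b a haJ
    · rw [mul_comm a b]
      exact hmul b a haJ
  refine conclude a haJ (hsq _ (hmul a a haJ) (hmul a b hbJ) ?_)
  have hlt1 : K < K ⊔ Ideal.span {a * b} :=
    SetLike.lt_iff_le_and_exists.2 ⟨le_sup_left, _,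
      Ideal.mem_sup_right (Ideal.mem_span_singleton_self _), h1⟩
  have hlt2 : K ⊔ Ideal.span {a * b} < K ⊔ Ideal.span {a * b} ⊔ Ideal.span {a * a} :=
    SetLike.lt_iff_le_and_exists.2 ⟨le_sup_left, _,
      Ideal.mem_sup_right (Ideal.mem_span_singleton_self _), h2⟩
  have hle : K ⊔ Ideal.span {a * b} ⊔ Ideal.span {a * a} ≤ J ^ 2 := by
    simp only [sup_le_iff, Ideal.span_singleton_le_iff_mem]
    exact ⟨⟨hKle, hmem a haJ b hbJ⟩, hmem a haJ a haJ⟩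
  have heq : K ⊔ Ideal.span {a * b} ⊔ Ideal.span {a * a} = J ^ 2 := by
    by_contra hne
    have l1 := hKr.colength_lt hlt1
    have l2 := (hKr.mono hlt1.le).colength_lt hlt2
    have l3 := (hKr.mono (hlt1.trans hlt2).le).colength_lt (lt_of_le_of_ne hle hne)
    omega
  have hbb := hmem b hbJ b hbJ
  rw [← heq] at hbb
  have hsup : K ⊔ Ideal.span {a * b} ⊔ Ideal.span {a * a} ≤ Ideal.span {a} * J ⊔ K := by
    simp only [sup_le_iff, Ideal.span_singleton_le_iff_mem]
    exact ⟨⟨le_sup_right, hmul a b hbJ⟩, hmul a a haJ⟩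
  exact hsup hbb

/-- If some `𝔪 ^ i I` has at most one generator, then `I` is principal. -/
lemma exists_eq_span_singleton_of_colength_pow_mul_le (hm : (maximalIdeal R).IsRegularIdeal)
    {I : Ideal R} (hI : I.IsRegularIdeal) (i : ℕ)
    (h : (maximalIdeal R ^ (i + 1) * I).colength ≤ (maximalIdeal R ^ i * I).colength + 1) :
    ∃ a ∈ I, I = Ideal.span {a} := by
  have hr := (hm.pow i).mul hI
  rw [pow_succ', mul_assoc] at h
  obtain ⟨w, -, hw⟩ := exists_eq_span_singleton_of_colength_le hm hr h
  -- 𝔪^i I is generated by a non-zero-divisor w, so I is invertible.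
  refine eq_span_singleton_of_mul_eq_span_singleton (J := maximalIdeal R ^ i) (w := w) ?_ ?_
  · exact hr.mem_nonZeroDivisors_of_le_span_singleton hw.le
  · rw [mul_comm, hw]

lemma colength_pow_add_two_le (hm : (maximalIdeal R).IsRegularIdeal)
    (hp : ¬ ∃ a, maximalIdeal R = Ideal.span {a}) (n : ℕ) (hn : 1 ≤ n) :
    (maximalIdeal R ^ n).colength + 2 ≤ (maximalIdeal R ^ (n + 1)).colength := by
  by_contra! hlt
  obtain ⟨n, rfl⟩ := Nat.exists_eq_add_of_le' hn
  obtain ⟨a, -, ha⟩ := exists_eq_span_singleton_of_colength_pow_mul_le hm hm n (by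
    rw [← pow_succ, ← pow_succ]
    omega)
  exact hp ⟨a, ha⟩

omit [IsNoetherianRing R] [Ring.KrullDimLE 1 R] in
lemma colength_maximalIdeal : (maximalIdeal R).colength = 1 := by
  have : IsSimpleModule R (R ⧸ maximalIdeal R) :=
    isSimpleModule_iff_isCoatom.2 (maximalIdeal.isMaximal R).out
  rw [Ideal.colength, Module.length_eq_one, ENat.toNat_one]

lemma le_colength_pow (hm : (maximalIdeal R).IsRegularIdeal)
    (hp : ¬ ∃ a, maximalIdeal R = Ideal.span {a}) (n : ℕ) :
    2 * n + 1 ≤ (maximalIdeal R ^ (n + 1)).colength := by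
  induction n with
  | zero => simp [colength_maximalIdeal]
  | succ n ih =>
    have := colength_pow_add_two_le hm hp (n + 1) (by omega)
    omega

end IsLocalRing

/-- If an increment at r or at 2r were at least 3 for every r, then a(N+1) + a(2N+1) would grow by 7
per step (three increments, one of them large), against an asymptotic rate of at most 2 · 3 = 6. -/
lemma AsympLeTwo.exists_increment_le_two {a : ℕ → ℕ} (h : AsympLeTwo a)
    (ha : ∀ n, 1 ≤ n → a n + 2 ≤ a (n + 1)) :
    ∃ r, 1 ≤ r ∧ a (r + 1) ≤ a r + 2 ∧ a (2 * r + 1) ≤ a (2 * r) + 2 := by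
  by_contra! hcon
  have key : ∀ N, 7 * N ≤ a (N + 1) + a (2 * N + 1) := by
    intro N
    induction N with
    | zero => omega
    | succ N ih =>
      have h1 := ha (N + 1) (by omega)
      have h2 : a (2 * N + 1) + 2 ≤ a (2 * N + 2) := ha (2 * N + 1) (by omega)
      have h3 := ha (2 * N + 2) (by omega)
      have h4 := hcon (N + 1) (by omega)
      rw [show 2 * (N + 1) = 2 * N + 2 by ring] at *
      omega
  -- Precision 1/6 gives 42N ≤ 13(3N + 2), false for N ≥ 9.
  obtain ⟨n₀, hn₀⟩ := eventually_atTop.1 (h 6)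
  have h1 := hn₀ (n₀ + 9 + 1) (by omega)
  have h2 := hn₀ (2 * (n₀ + 9) + 1) (by omega)
  have h3 := key (n₀ + 9)
  omega

namespace IsLocalRing

open Ideal

variable {R : Type*} [CommRing R] [IsLocalRing R] [IsNoetherianRing R] [Ring.KrullDimLE 1 R]

/-- A power of the maximal ideal contains an element of the colength expected of a reduction of
that power, when the multiplicity is at most two. -/
lemma exists_mem_pow_colength_le (hm : (maximalIdeal R).IsRegularIdeal)
    (hR : AsympLeTwo fun n ↦ (maximalIdeal R ^ n).colength) :
    ∃ r, 1 ≤ r ∧ ∃ y ∈ maximalIdeal R ^ r, y ∈ R⁰ ∧ (Ideal.span {y}).colength ≤ 2 * r := by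
  by_cases hp : ∃ a, maximalIdeal R = Ideal.span {a}
  · obtain ⟨a, ha⟩ := hp
    refine ⟨1, le_rfl, a, by simp [ha],
      hm.mem_nonZeroDivisors_of_le_span_singleton ha.le, ?_⟩
    rw [← ha, colength_maximalIdeal]
    omega
  obtain ⟨r, hr, h1, h2⟩ := hR.exists_increment_le_two (colength_pow_add_two_le hm hp)
  rw [pow_succ'] at h1 h2
  obtain ⟨a, b, hab⟩ := exists_eq_span_pair_of_colength_le hm (hm.pow r) h1
  obtain ⟨y, hy, hsq⟩ := exists_sq_eq_span_singleton_mul_of_colength_le hm (hm.pow r) hab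
    (by rwa [← pow_mul, mul_comm r])
  have hy0 : y ∈ R⁰ := ((hm.pow r).pow 2).mem_nonZeroDivisors_of_le_span_singleton
    (hsq.le.trans Ideal.mul_le_left)
  refine ⟨r, hr, y, hy, hy0, ?_⟩
  have hpow : ∀ k, (maximalIdeal R ^ ((k + 1) * r)).colength =
      k * (Ideal.span {y}).colength + (maximalIdeal R ^ r).colength := by
    intro k
    induction k with
    | zero => simp
    | succ k ih =>
      have : maximalIdeal R ^ ((k + 1 + 1) * r) =
          Ideal.span {y} * maximalIdeal R ^ ((k + 1) * r) := by
        rw [show (k + 1 + 1) * r = r * 2 + k * r by ring, pow_add, pow_mul, hsq,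
          show (k + 1) * r = r + k * r by ring, pow_add, mul_assoc]
      rw [this, (hm.pow _).colength_span_singleton_mul hy0, ih]
      ring
  by_contra! hlt
  -- If ℓ(R/y) ≥ 2r + 1, the growth rate is at least 2 + 1/r, which exceeds the allowed 2 + 1/(2r).
  obtain ⟨n₀, hn₀⟩ := eventually_atTop.1 (hR (2 * r))
  set k := n₀ + 4 * r + 2 with hk
  have h3 := hn₀ ((k + 1) * r) (by nlinarith)
  simp only [hpow] at h3
  have h4 : k * (2 * r + 1) ≤ k * (Ideal.span {y}).colength := by gcongr; omega
  have h5 : 2 * r * (k * (2 * r + 1)) ≤ (2 * (2 * r) + 1) * ((k + 1) * r) := by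
    refine le_trans ?_ h3
    gcongr
    omega
  have h6 : 2 * (k * (2 * r + 1)) ≤ (2 * (2 * r) + 1) * (k + 1) :=
    Nat.le_of_mul_le_mul_left (c := r) (by linarith) (by omega)
  nlinarith

/-- In a one-dimensional Cohen-Macaulay local ring of multiplicity at most two, every regular ideal
has a principal reduction with reduction number at most one. -/
theorem exists_sq_eq_span_singleton_mul (hm : (maximalIdeal R).IsRegularIdeal)
    (hR : AsympLeTwo fun n ↦ (maximalIdeal R ^ n).colength) {I : Ideal R}
    (hI : I.IsRegularIdeal) : ∃ c ∈ I, I ^ 2 = Ideal.span {c} * I := by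
  -- If ℓ(L/𝔪L) ≥ 3, then L is not principal, so each later increment is at least 2 and ℓ(R/𝔪^r L) ≥
  -- ℓ(R/L) + 2r + 1. But yL ⊆ 𝔪^r L has colength at most ℓ(R/L) + 2r.
  have key : ∀ L : Ideal R, L.IsRegularIdeal →
      (maximalIdeal R * L).colength ≤ L.colength + 2 := by
    intro L hL
    by_contra! hcon
    have hstep : ∀ i, (maximalIdeal R ^ i * L).colength + 2 ≤
        (maximalIdeal R ^ (i + 1) * L).colength := by
      intro i
      by_contra! hlt
      obtain ⟨c, -, hc⟩ := exists_eq_span_singleton_of_colength_pow_mul_le hm hL i (by omega)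
      have hc0 := hL.mem_nonZeroDivisors_of_le_span_singleton hc.le
      rw [mul_comm, hc, hm.colength_span_singleton_mul hc0, colength_maximalIdeal] at hcon
      omega
    have hsum : ∀ i, (maximalIdeal R * L).colength + 2 * i ≤
        (maximalIdeal R ^ (i + 1) * L).colength := by
      intro i
      induction i with
      | zero => simp
      | succ i ih =>
        have := hstep (i + 1)
        omega
    obtain ⟨r, hr, y, hy, hy0, hyr⟩ := exists_mem_pow_colength_le hm hR
    obtain ⟨r, rfl⟩ := Nat.exists_eq_add_of_le' hr
    have h1 := ((IsRegularIdeal.span_singleton hy0).mul hL).colength_le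
      (Ideal.mul_mono_left (K := L) ((Ideal.span_singleton_le_iff_mem _).2 hy))
    rw [hL.colength_span_singleton_mul hy0] at h1
    have := hsum r
    omega
  obtain ⟨a, b, hab⟩ := exists_eq_span_pair_of_colength_le hm hI (key I hI)
  exact exists_sq_eq_span_singleton_mul_of_colength_le hm hI hab (key _ (hI.pow 2))

end IsLocalRing

/-! ### Passing between limits and integer inequalities. -/

lemma tendsto_natCast_div_ennreal {a : ℕ → ℕ} {e : ℝ}
    (h : Tendsto (fun n ↦ (a n : ℝ) / n) atTop (𝓝 e)) :
    Tendsto (fun n : ℕ ↦ (a n : ℝ≥0∞) / (n : ℝ≥0∞)) atTop (𝓝 (ENNReal.ofReal e)) := by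
  refine (ENNReal.tendsto_ofReal h).congr' ?_
  filter_upwards [eventually_gt_atTop 0] with n hn
  rw [ENNReal.ofReal_div_of_pos (by exact_mod_cast hn), ENNReal.ofReal_natCast,
    ENNReal.ofReal_natCast]

lemma AsympLeTwo.of_tendsto {a : ℕ → ℕ} {e : ℝ≥0∞} (he : e ≤ 2)
    (h : Tendsto (fun n : ℕ ↦ (a n : ℝ≥0∞) / (n : ℝ≥0∞)) atTop (𝓝 e)) : AsympLeTwo a := by
  intro k
  rcases Nat.eq_zero_or_pos k with rfl | hk
  · simp
  have hlt : e < (2 * k + 1 : ℕ) / (k : ℝ≥0∞) := by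
    refine he.trans_lt ?_
    rw [ENNReal.lt_div_iff_mul_lt (by simp) (by simp)]
    exact_mod_cast Nat.lt_succ_self _
  filter_upwards [h.eventually_lt_const hlt, eventually_gt_atTop 0] with n hn hn0
  have hk0 : (k : ℝ≥0∞) ≠ 0 := by exact_mod_cast hk.ne'
  have hn0' : (n : ℝ≥0∞) ≠ 0 := by exact_mod_cast hn0.ne'
  have h1 := (ENNReal.div_le_iff hn0' (by simp)).1 hn.le
  have h2 : (k : ℝ≥0∞) * a n ≤ (2 * k + 1 : ℕ) * n := by
    calc (k : ℝ≥0∞) * a n ≤ k * ((2 * k + 1 : ℕ) / (k : ℝ≥0∞) * n) := by gcongr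
      _ = (2 * k + 1 : ℕ) * n := by
        rw [← mul_assoc, ENNReal.mul_div_cancel hk0 (by simp)]
  exact_mod_cast h2

lemma AsympLeTwo.of_le_add {a b : ℕ → ℕ} {c : ℕ} (h : AsympLeTwo b) (hab : ∀ n, a n ≤ b n + c) :
    AsympLeTwo a := by
  intro k
  -- Doubling the precision leaves slack n, which absorbs 2kc.
  filter_upwards [h (2 * k), eventually_ge_atTop (2 * k * c)] with n h1 h2
  nlinarith [Nat.mul_le_mul_left (2 * k) (hab n)]

lemma AsympLeTwo.tendsto {a : ℕ → ℕ} (h : AsympLeTwo a) (ha : ∀ n, 2 * n + 1 ≤ a (n + 1)) :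
    Tendsto (fun n ↦ (a n : ℝ) / n) atTop (𝓝 2) := by
  rw [Metric.tendsto_atTop]
  intro ε hε
  obtain ⟨k, hk⟩ := exists_nat_gt (2 / ε)
  obtain ⟨n₀, hn₀⟩ := eventually_atTop.1 (h k)
  have hk0 : (0 : ℝ) < k := lt_trans (by positivity) hk
  refine ⟨n₀ + k + 1, fun n hn ↦ ?_⟩
  have hn0 : (0 : ℝ) < n := by exact_mod_cast (by omega : 0 < n)
  have hkn : (k : ℝ) ≤ n := by exact_mod_cast (by omega : k ≤ n)
  have h1 : (k : ℝ) * a n ≤ (2 * k + 1) * n := by exact_mod_cast hn₀ n (by omega)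
  have h2 : (2 : ℝ) * n ≤ a n + 1 := by
    have := ha (n - 1)
    rw [Nat.sub_add_cancel (by omega)] at this
    exact_mod_cast (by omega : 2 * n ≤ a n + 1)
  have hεk : 2 < k * ε := (div_lt_iff₀ hε).1 hk
  rw [Real.dist_eq, div_sub' hn0.ne', abs_div, abs_of_pos hn0, div_lt_iff₀ hn0, abs_lt]
  constructor
  · nlinarith
  · have : (k : ℝ) * (a n - n * 2) < k * (ε * n) := by nlinarith
    exact lt_of_mul_lt_mul_left this hk0.le

namespace IsLocalRing

open Ideal

variable {R : Type*} [CommRing R] [IsLocalRing R] [IsNoetherianRing R] [Ring.KrullDimLE 1 R]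

lemma hasMultiplicity_iff_tendsto (hdim : ringKrullDim R = 1)
    (hm : (maximalIdeal R).IsRegularIdeal) (e : ℝ≥0∞) :
    HasMultiplicity R e ↔ Tendsto (fun n : ℕ ↦ ((maximalIdeal R ^ n).colength : ℝ≥0∞) / n)
      atTop (𝓝 e) := by
  have hcongr : (fun n : ℕ ↦ ((1 ! : ℕ) : ℝ≥0∞) *
      (Module.length R (R ⧸ IsLocalRing.maximalIdeal R ^ n) : ℝ≥0∞) / (n : ℝ≥0∞) ^ 1) =
      fun n : ℕ ↦ ((maximalIdeal R ^ n).colength : ℝ≥0∞) / n := by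
    ext n
    rw [← (hm.pow n).coe_colength]
    simp
  constructor
  · rintro ⟨d, hd, h⟩
    obtain rfl : d = 1 := by
      rw [hdim] at hd
      exact_mod_cast hd.symm
    rwa [hcongr] at h
  · intro h
    exact ⟨1, by simpa using hdim, by rwa [hcongr]⟩

lemma asympLeTwo_of_hasMultiplicity (hdim : ringKrullDim R = 1)
    (hm : (maximalIdeal R).IsRegularIdeal) {e : ℝ≥0∞} (h : HasMultiplicity R e) (he : e ≤ 2) :
    AsympLeTwo fun n ↦ (maximalIdeal R ^ n).colength :=
  .of_tendsto he ((hasMultiplicity_iff_tendsto hdim hm e).1 h)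

lemma exists_hasMultiplicity_le_two (hdim : ringKrullDim R = 1)
    (hm : (maximalIdeal R).IsRegularIdeal)
    (hR : AsympLeTwo fun n ↦ (maximalIdeal R ^ n).colength) :
    ∃ e, HasMultiplicity R e ∧ e ≤ 2 := by
  simp only [hasMultiplicity_iff_tendsto hdim hm]
  by_cases hp : ∃ a, maximalIdeal R = Ideal.span {a}
  · obtain ⟨a, ha⟩ := hp
    have ha0 := hm.mem_nonZeroDivisors_of_le_span_singleton ha.le
    have hlen : ∀ n, (maximalIdeal R ^ n).colength = n := by
      intro n
      induction n with
      | zero => rw [pow_zero, Ideal.one_eq_top, colength_top]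
      | succ n ih =>
        have h1 := (hm.pow n).colength_span_singleton_mul ha0
        rw [← ha, colength_maximalIdeal, ih, ← pow_succ'] at h1
        rw [h1, add_comm]
    refine ⟨1, ?_, by norm_num⟩
    refine tendsto_const_nhds.congr' ?_
    filter_upwards [eventually_gt_atTop 0] with n hn
    rw [hlen, ENNReal.div_self (by exact_mod_cast hn.ne') (by simp)]
  · refine ⟨2, ?_, le_rfl⟩
    have := tendsto_natCast_div_ennreal (hR.tendsto (le_colength_pow hm hp))
    simpa using this

end IsLocalRing

/-- The length of the quotient by a power of a maximal ideal is unchanged by localization. -/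
lemma Ideal.colength_maximalIdeal_localization_pow {R : Type*} [CommRing R] (M : Ideal R)
    [M.IsMaximal] (n : ℕ) :
    (IsLocalRing.maximalIdeal (Localization.AtPrime M) ^ n).colength = (M ^ n).colength := by
  let e := IsLocalization.AtPrime.equivQuotMaximalIdealPow M (Localization.AtPrime M) n
  have hsurj : Function.Surjective (algebraMap R
      (Localization.AtPrime M ⧸ IsLocalRing.maximalIdeal (Localization.AtPrime M) ^ n)) := by
    intro y
    obtain ⟨x, rfl⟩ := e.surjective y
    obtain ⟨x, rfl⟩ := Ideal.Quotient.mk_surjective x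
    exact ⟨x, (e.commutes x).symm⟩
  -- `R` and its localization both surject onto this quotient ring, so its length over either is its
  -- length over itself.
  have h1 := e.toLinearEquiv.length_eq
  have h2 := Module.length_eq_of_surjective (M := Localization.AtPrime M ⧸
    IsLocalRing.maximalIdeal (Localization.AtPrime M) ^ n) hsurj
  have hsurj' : Function.Surjective (algebraMap (Localization.AtPrime M)
      (Localization.AtPrime M ⧸ IsLocalRing.maximalIdeal (Localization.AtPrime M) ^ n)) :=
    Ideal.Quotient.mk_surjective
  have h3 := Module.length_eq_of_surjective
    (M := Localization.AtPrime M ⧸ IsLocalRing.maximalIdeal (Localization.AtPrime M) ^ n) hsurj'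
  rw [colength, colength, h3, ← h2, h1]

/-! ### Dimension and the Cohen–Macaulay property, locally and in finite extensions. -/

section LocalRing

open IsLocalRing

variable {R : Type*} [CommRing R] [IsLocalRing R] [Ring.KrullDimLE 1 R]

lemma ringKrullDim_eq_one_of_isRegularIdeal (hm : (maximalIdeal R).IsRegularIdeal) :
    ringKrullDim R = 1 := by
  obtain ⟨x, hx, hx0⟩ := hm
  refine le_antisymm ((Order.krullDimLE_iff _ _).1 ‹Ring.KrullDimLE 1 R›) ?_
  have : Nontrivial (R ⧸ Ideal.span {x}) :=
    Ideal.Quotient.nontrivial_iff.2 (by simpa [Ideal.span_singleton_eq_top] using hx)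
  have h1 : (0 : WithBot ℕ∞) ≤ ringKrullDim (R ⧸ Ideal.span {x}) :=
    ringKrullDim_nonneg_of_nontrivial
  calc (1 : WithBot ℕ∞) = 0 + 1 := by simp
    _ ≤ ringKrullDim (R ⧸ Ideal.span {x}) + 1 := by gcongr
    _ ≤ ringKrullDim R := ringKrullDim_quotient_succ_le_of_nonZeroDivisor hx0

lemma isCohenMacaulayLocal_of_isRegularIdeal [IsNoetherianRing R]
    (hm : (maximalIdeal R).IsRegularIdeal) : IsCohenMacaulayLocal R := by
  refine ⟨inferInstance, ?_⟩
  have hdim := ringKrullDim_eq_one_of_isRegularIdeal hm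
  obtain ⟨x, hx, hx0⟩ := hm
  have hmem : ∀ r ∈ [x], r ∈ maximalIdeal R := by simpa using hx
  refine ⟨[x], hmem, ?_, by simpa using hdim⟩
  rw [IsLocalRing.isRegular_iff_isWeaklyRegular_of_subset_maximalIdeal hmem,
    RingTheory.Sequence.isWeaklyRegular_singleton_iff]
  exact Module.Flat.isSMulRegular_of_nonZeroDivisors hx0

omit [Ring.KrullDimLE 1 R] in
lemma IsCohenMacaulayLocal.isRegularIdeal (h : IsCohenMacaulayLocal R)
    (hdim : ringKrullDim R = 1) : (maximalIdeal R).IsRegularIdeal := by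
  obtain ⟨-, rs, hrs, hreg, hlen⟩ := h
  have hlen : rs.length = 1 := by
    rw [hdim] at hlen
    exact_mod_cast hlen.symm
  obtain ⟨x, rfl⟩ := List.length_eq_one_iff.1 hlen
  refine ⟨x, hrs x (by simp), mem_nonZeroDivisors_iff_right.2 fun y hy ↦ ?_⟩
  have := (RingTheory.Sequence.isWeaklyRegular_singleton_iff R x).1 hreg.toIsWeaklyRegular
  exact this (by simpa [mul_comm] using hy)

end LocalRing

section FiniteExtension

open IsLocalRing

variable {A B : Type*} [CommRing A] [IsLocalRing A] [CommRing B] [Algebra A B] [Module.Finite A B]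

lemma algebraMap_mem_of_isMaximal {x : A} (hx : x ∈ maximalIdeal A) (M : Ideal B) [M.IsMaximal] :
    algebraMap A B x ∈ M := by
  have h := IsLocalRing.eq_maximalIdeal
    (Ideal.isMaximal_comap_of_isIntegral_of_isMaximal (R := A) M)
  rw [← h] at hx
  exact hx

lemma finite_maximalSpectrum_of_finite (A B : Type*) [CommRing A] [IsLocalRing A] [CommRing B]
    [Algebra A B] [Module.Finite A B] : Finite (MaximalSpectrum B) := by
  have := (Algebra.QuasiFinite.finite_primesOver (S := B) (maximalIdeal A)).to_subtype
  refine Finite.of_injective (β := (maximalIdeal A).primesOver B)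
    (fun M ↦ ⟨M.asIdeal, M.isMaximal.isPrime, ⟨?_⟩⟩) fun M N h ↦ ?_
  · have := M.isMaximal
    exact (IsLocalRing.eq_maximalIdeal
      (Ideal.isMaximal_comap_of_isIntegral_of_isMaximal (R := A) M.asIdeal)).symm
  · exact MaximalSpectrum.ext (congrArg Subtype.val h)

/-- A/x is zero-dimensional, hence so is B/xB by integrality. As x lies in every maximal ideal of B,
these have height at most 1. -/
lemma krullDimLE_one_of_finite [IsNoetherianRing A] [IsNoetherianRing B]
    (hdim : ringKrullDim A = 1) {x : A} (hx : x ∈ maximalIdeal A)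
    (hxA : x ∈ A⁰) : Ring.KrullDimLE 1 B := by
  have hA : Ring.KrullDimLE 0 (A ⧸ Ideal.span {x}) := by
    rw [Ring.KrullDimLE, Order.krullDimLE_iff, ← ENat.WithBot.add_le_add_one_right_iff,
      Nat.cast_zero, zero_add]
    exact (ringKrullDim_quotient_succ_le_of_nonZeroDivisor hxA).trans hdim.le
  rw [Ideal.krullDimLE_zero_quotient_iff_forall_minimalPrimes_isMaximal] at hA
  have hB : Ring.KrullDimLE 0 (B ⧸ Ideal.span {algebraMap A B x}) := by
    rw [Ideal.krullDimLE_zero_quotient_iff_forall_minimalPrimes_isMaximal]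
    intro P hP
    have := hP.1.1
    refine Ideal.isMaximal_of_isIntegral_of_isMaximal_comap (R := A) P ?_
    have hle : Ideal.span {x} ≤ P.comap (algebraMap A B) :=
      (Ideal.span_singleton_le_iff_mem _).2 (hP.1.2 (Ideal.mem_span_singleton_self _))
    obtain ⟨q, hq, hqP⟩ := Ideal.exists_minimalPrimes_le hle
    have hqm := hA q hq
    rwa [← hqm.eq_of_le (Ideal.IsPrime.ne_top inferInstance) hqP]
  rw [Ring.KrullDimLE, Order.krullDimLE_iff]
  refine (ringKrullDim_le_iff_isMaximal_height_le (1 : ℕ)).2 fun M hM ↦ ?_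
  have h1 := Ideal.height_le_ringKrullDim_quotient_add_one (algebraMap_mem_of_isMaximal hx M)
  have h2 : ringKrullDim (B ⧸ Ideal.span {algebraMap A B x}) ≤ (0 : ℕ) :=
    (Order.krullDimLE_iff _ _).1 hB
  refine h1.trans ?_
  calc ringKrullDim (B ⧸ Ideal.span {algebraMap A B x}) + 1 ≤ (0 : ℕ) + 1 := by gcongr
    _ = (1 : ℕ) := by simp

lemma krullDimLE_localization_atPrime [Ring.KrullDimLE 1 B] (M : Ideal B) [M.IsPrime] :
    Ring.KrullDimLE 1 (Localization.AtPrime M) := by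
  rw [Ring.KrullDimLE, Order.krullDimLE_iff]
  change ringKrullDim _ ≤ _
  rw [IsLocalization.AtPrime.ringKrullDim_eq_height M]
  exact Ideal.height_le_ringKrullDim_of_isPrime.trans ((Order.krullDimLE_iff _ _).1 ‹Ring.KrullDimLE 1 B›)

lemma Ideal.IsRegularIdeal.map_localization_atPrime {I : Ideal B} (hI : I.IsRegularIdeal)
    (M : Ideal B) [M.IsPrime] :
    (I.map (algebraMap B (Localization.AtPrime M))).IsRegularIdeal :=
  let ⟨_, ha, ha'⟩ := hI
  ⟨_, Ideal.mem_map_of_mem _ ha,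
    IsLocalization.nonZeroDivisors_le_comap M.primeCompl (Localization.AtPrime M) ha'⟩

lemma Ideal.IsRegularIdeal.maximalIdeal_localization {M : Ideal B} [M.IsPrime]
    (hM : M.IsRegularIdeal) : (maximalIdeal (Localization.AtPrime M)).IsRegularIdeal :=
  Localization.AtPrime.map_eq_maximalIdeal (I := M) ▸ hM.map_localization_atPrime M

end FiniteExtension

/-! ### Hilbert functions under birational extension. -/

section Birational

variable {C D : Type*} [CommRing C] [CommRing D] [Algebra C D]

/-- Comparison of Hilbert functions along an extension of rings whose conductor contains a
non-zero-divisor `s`. -/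
lemma Ideal.colength_pow_le_colength_comap_pow_add [IsNoetherianRing C] [Ring.KrullDimLE 1 C]
    (hinj : Function.Injective (algebraMap C D)) {s : C} (hs : s ∈ C⁰)
    (hsD : algebraMap C D s ∈ D⁰)
    (hcond : ∀ d : D, ∃ c : C, algebraMap C D c = algebraMap C D s * d) (N : Ideal D)
    (hN : (N.comap (algebraMap C D)).IsRegularIdeal) (n : ℕ) :
    (N ^ n).colength ≤ (N.comap (algebraMap C D) ^ n).colength + (Ideal.span {s}).colength := by
  set M := N.comap (algebraMap C D) with hM
  choose f hf using hcond
  let ψ : D →ₗ[C] C :=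
    { toFun := f
      map_add' := fun a b ↦ hinj (by simp [hf, mul_add])
      map_smul' := fun c a ↦ hinj (by simp [hf, Algebra.smul_def, mul_left_comm]) }
  let I := Ideal.span {s} * M ^ n
  have hI : I.IsRegularIdeal := (IsRegularIdeal.span_singleton hs).mul (hN.pow n)
  -- `ψ` is multiplication by s, so W consists of the d with sd ∈ sMⁿ. Cancelling s puts d in the
  -- image of Mⁿ, hence in Nⁿ, so D/Nⁿ is a quotient of D/W, which embeds in C/sMⁿ.
  let W : Submodule C D := Submodule.comap ψ I
  have hW : W ≤ LinearMap.ker (Ideal.Quotient.mkₐ C (N ^ n)).toLinearMap := by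
    intro d hd
    obtain ⟨m, hm, hsm⟩ := Ideal.mem_span_singleton_mul.1 (show f d ∈ I from hd)
    have h1 : algebraMap C D s * (d - algebraMap C D m) = 0 := by
      rw [mul_sub, ← map_mul, hsm, hf, sub_self]
    have h2 : d = algebraMap C D m :=
      sub_eq_zero.1 ((mem_nonZeroDivisors_iff.1 hsD).1 _ h1)
    have h3 : M ^ n ≤ (N ^ n).comap (algebraMap C D) := Ideal.le_comap_pow _ n
    rw [LinearMap.mem_ker]
    exact Ideal.Quotient.eq_zero_iff_mem.2 (h2 ▸ h3 hm)
  have l1 : Module.length D (D ⧸ N ^ n) ≤ Module.length C (D ⧸ N ^ n) := by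
    have := Submodule.length_le_length_restrictScalars C (⊤ : Submodule D (D ⧸ N ^ n))
    rwa [Submodule.restrictScalars_top, Module.length_top, Module.length_top] at this
  have l2 : Module.length C (D ⧸ N ^ n) ≤ Module.length C (D ⧸ W) := by
    refine Module.length_le_of_surjective (W.liftQ _ hW) fun y ↦ ?_
    obtain ⟨d, rfl⟩ := Ideal.Quotient.mk_surjective y
    exact ⟨Submodule.Quotient.mk d, rfl⟩
  have l3 : Module.length C (D ⧸ W) ≤ Module.length C (C ⧸ I) :=
    Module.length_le_of_injective (W.mapQ I ψ le_rfl) (by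
      rw [← LinearMap.ker_eq_bot, Submodule.mapQ, Submodule.ker_liftQ_eq_bot']
      rw [LinearMap.ker_comp, Submodule.ker_mkQ])
  have l4 := (l1.trans l2).trans l3
  rw [← hI.coe_colength, (hN.pow n).colength_span_singleton_mul hs] at l4
  rw [add_comm]
  exact ENat.toNat_le_of_le_natCast l4

end Birational

/-! ### Stability from local principal reductions. -/

lemma Ideal.span_singleton_mul_le_of_sq_eq {R : Type*} [CommRing R] {I : Ideal R}
    (hI : I.IsRegularIdeal) {c : R} (hc : I ^ 2 = Ideal.span {c} * I) {p s : R} (n : ℕ)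
    (h : Ideal.span {p} * I ^ (n + 1) ≤ Ideal.span {s} * I ^ (n + 1)) :
    Ideal.span {p} * I ≤ Ideal.span {s} * I := by
  have hc0 : c ∈ R⁰ := (hI.pow 2).mem_nonZeroDivisors_of_le_span_singleton
    (hc.le.trans Ideal.mul_le_left)
  have hpow : ∀ n, I ^ (n + 1) = Ideal.span {c ^ n} * I := by
    intro n
    induction n with
    | zero => simp
    | succ n ih =>
      rw [pow_succ, ih, mul_assoc, ← sq, hc, ← mul_assoc, Ideal.span_singleton_mul_span_singleton,
        pow_succ]
  rw [hpow, mul_left_comm, mul_left_comm (Ideal.span {s})] at h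
  intro x hx
  obtain ⟨y, hy, hxy⟩ := Ideal.mem_span_singleton_mul.1
    (h (Ideal.mul_mem_mul (Ideal.mem_span_singleton_self (c ^ n)) hx))
  have h1 : c ^ n * (y - x) = 0 := by rw [mul_sub, hxy, sub_self]
  rwa [← sub_eq_zero.1 ((mem_nonZeroDivisors_iff.1 (pow_mem hc0 n)).1 _ h1)]

/-- Clearing denominators turns the colon in the total quotient ring into a containment of ideals,
which can be checked locally. -/
lemma mem_endColon_mk'_iff {R : Type*} [CommRing R] (I : Ideal R) (p : R) (s : R⁰) :
    IsLocalization.mk' (FractionRing R) p s ∈ endColon I ↔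
      Ideal.span {p} * I ≤ Ideal.span {(s : R)} * I := by
  rw [endColon, Submodule.mem_div_iff_forall_mul_mem, Ideal.span_singleton_mul_le_iff]
  have key : ∀ y z : R, IsLocalization.mk' (FractionRing R) p s * algebraMap R _ y =
      algebraMap R _ z ↔ p * y = s * z := by
    intro y z
    rw [mul_comm, IsLocalization.mul_mk'_eq_mk'_of_mul, IsLocalization.mk'_eq_iff_eq_mul, ← map_mul,
      (IsFractionRing.injective R (FractionRing R)).eq_iff, mul_comm y, mul_comm z]
  constructor
  · intro h y hy
    obtain ⟨z, hz, hyz⟩ := h (algebraMap R _ y) (Submodule.mem_map_of_mem hy)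
    exact Ideal.mem_span_singleton_mul.2 ⟨z, hz, ((key y z).1 hyz.symm).symm⟩
  · rintro h _ ⟨y, hy, rfl⟩
    obtain ⟨z, hz, hyz⟩ := Ideal.mem_span_singleton_mul.1 (h y hy)
    exact ⟨z, hz, ((key y z).2 hyz.symm).symm⟩

/-- Stability of an ideal follows if, locally, it has a principal reduction with reduction number at
most one. -/
lemma isStableIdeal_of_localization {R : Type*} [CommRing R] {I : Ideal R} (hI : I.IsRegularIdeal)
    (h : ∀ (M : Ideal R) [M.IsMaximal], ∃ c, I.map (algebraMap R (Localization.AtPrime M)) ^ 2 =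
      Ideal.span {c} * I.map (algebraMap R (Localization.AtPrime M))) : IsStableIdeal I := by
  refine Set.Subset.antisymm ?_ fun z hz ↦ ⟨1, le_rfl, by simpa using hz⟩
  rintro z ⟨n, hn, hz⟩
  obtain ⟨n, rfl⟩ := Nat.exists_eq_add_of_le' hn
  obtain ⟨p, s, rfl⟩ := IsLocalization.exists_mk'_eq R⁰ z
  rw [SetLike.mem_coe, mem_endColon_mk'_iff]
  rw [mem_endColon_mk'_iff] at hz
  refine Ideal.le_of_localization_maximal fun M hM ↦ ?_
  obtain ⟨c, hc⟩ := h M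
  have hz' := Ideal.map_mono (f := algebraMap R (Localization.AtPrime M)) hz
  simp only [Ideal.map_mul, Ideal.map_pow, Ideal.map_span, Set.image_singleton] at hz' ⊢
  exact Ideal.span_singleton_mul_le_of_sq_eq (hI.map_localization_atPrime M) hc n hz'

lemma algebraMap_mem_nonZeroDivisors_of_isFractionRing {C K : Type*} [CommRing C] [CommRing K]
    [Algebra C K] [IsFractionRing C K] (D : Subalgebra C K) {s : C} (hs : s ∈ C⁰) :
    algebraMap C D s ∈ D⁰ := by
  have h := IsLocalization.nonZeroDivisors_le_comap C⁰ K hs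
  refine mem_nonZeroDivisors_iff_right.2 fun d hd ↦ ?_
  have := (mem_nonZeroDivisors_iff_right.1 h) (d : K) (by
    have := congrArg (Subtype.val : D → K) hd
    simpa using this)
  exact_mod_cast this

/-- Local data of a finite extension of a one-dimensional Cohen-Macaulay local ring on which a
parameter stays a non-zero-divisor. -/
lemma krullDimLE_one_and_isRegularIdeal_of_finite {A B : Type*} [CommRing A] [IsLocalRing A]
    [IsNoetherianRing A] [CommRing B] [IsNoetherianRing B] [Algebra A B] [Module.Finite A B]
    (hdim : ringKrullDim A = 1) {x : A} (hx : x ∈ IsLocalRing.maximalIdeal A) (hxA : x ∈ A⁰)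
    (hxB : algebraMap A B x ∈ B⁰) :
    Ring.KrullDimLE 1 B ∧ ∀ (M : Ideal B) [M.IsMaximal], M.IsRegularIdeal :=
  ⟨krullDimLE_one_of_finite hdim hx hxA, fun M _ ↦ ⟨_, algebraMap_mem_of_isMaximal hx M, hxB⟩⟩

/-! ### Assembly of both conclusions. -/

open IsLocalRing in
theorem proposition2p3 {A : Type*} [CommRing A] [IsLocalRing A]
    (hCM : IsCohenMacaulayLocal A) (hdim : ringKrullDim A = 1)
    {Q : Type*} [CommRing Q] [Algebra A Q] [IsFractionRing A Q]
    (C : Subalgebra A Q) (hfin : Module.Finite A C)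
    (hC : ∀ (M : Ideal C) [M.IsMaximal],
      ∃ e : ℝ≥0∞, HasMultiplicity (Localization.AtPrime M) e ∧ e ≤ 2) :
    (∀ (K : Type*) [CommRing K] [Algebra C K] [IsFractionRing C K]
      (D : Subalgebra C K), Module.Finite C D → ∀ (N : Ideal D) [N.IsMaximal],
        ∃ e : ℝ≥0∞, HasMultiplicity (Localization.AtPrime N) e ∧ e ≤ 2) ∧
    IsArfRing C := by
  have hA : IsNoetherianRing A := hCM.1
  obtain ⟨x, hx, hxA⟩ := hCM.isRegularIdeal hdim
  have hCnoeth : IsNoetherianRing C := IsNoetherianRing.of_finite A C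
  have hxC := algebraMap_mem_nonZeroDivisors_of_isFractionRing C hxA
  obtain ⟨hC1, hCreg⟩ := krullDimLE_one_and_isRegularIdeal_of_finite (B := C) hdim hx hxA hxC
  have hloc : ∀ (M : Ideal C) [M.IsMaximal], Ring.KrullDimLE 1 (Localization.AtPrime M) ∧
      (maximalIdeal (Localization.AtPrime M)).IsRegularIdeal := fun M _ ↦
    ⟨krullDimLE_localization_atPrime M, (hCreg M).maximalIdeal_localization⟩
  have hasymp : ∀ (M : Ideal C) [M.IsMaximal],
      AsympLeTwo fun n ↦ (maximalIdeal (Localization.AtPrime M) ^ n).colength := by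
    intro M _
    obtain ⟨h1, hreg⟩ := hloc M
    obtain ⟨e, he, he2⟩ := hC M
    exact asympLeTwo_of_hasMultiplicity (ringKrullDim_eq_one_of_isRegularIdeal hreg) hreg he he2
  refine ⟨?_, ?_⟩
  · intro K _ _ _ D hD N _
    have hDnoeth : IsNoetherianRing D := IsNoetherianRing.of_finite C D
    let _ : Algebra A D := ((algebraMap C D).comp (algebraMap A C)).toAlgebra
    have : IsScalarTower A C D := .of_algebraMap_eq' rfl
    have : Module.Finite A D := .trans C D
    have hxD : algebraMap A D x ∈ D⁰ := algebraMap_mem_nonZeroDivisors_of_isFractionRing D hxC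
    obtain ⟨hD1, hDreg⟩ := krullDimLE_one_and_isRegularIdeal_of_finite (B := D) hdim hx hxA hxD
    have h1 : Ring.KrullDimLE 1 (Localization.AtPrime N) := krullDimLE_localization_atPrime N
    have hreg := (hDreg N).maximalIdeal_localization
    have hM : (N.comap (algebraMap C D)).IsMaximal :=
      Ideal.isMaximal_comap_of_isIntegral_of_isMaximal N
    -- A common denominator of the finitely many generators of D: sD ⊆ C.
    obtain ⟨s, hs, hsD⟩ := FractionalIdeal.isFractional_of_fg (S := C⁰)
      (I := Subalgebra.toSubmodule D) (Module.Finite.iff_fg.1 hD)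
    have hinj : Function.Injective (algebraMap C D) := by
      intro a b hab
      exact IsFractionRing.injective C K (congrArg (Subtype.val : D → K) hab)
    refine exists_hasMultiplicity_le_two (ringKrullDim_eq_one_of_isRegularIdeal hreg) hreg ?_
    refine (hasymp (N.comap (algebraMap C D))).of_le_add (c := (Ideal.span {s}).colength) fun n ↦ ?_
    rw [Ideal.colength_maximalIdeal_localization_pow, Ideal.colength_maximalIdeal_localization_pow]
    refine Ideal.colength_pow_le_colength_comap_pow_add hinj hs
      (algebraMap_mem_nonZeroDivisors_of_isFractionRing D hs) (fun d ↦ ?_) N (hCreg _) n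
    obtain ⟨c, hc⟩ := hsD d d.2
    exact ⟨c, Subtype.ext (by simpa [Algebra.smul_def] using hc)⟩
  · refine ⟨hCnoeth, finite_maximalSpectrum_of_finite A C, fun M _ ↦ ?_, fun M _ ↦ ?_,
      fun I hI _ ↦ isStableIdeal_of_localization hI fun M _ ↦ ?_⟩ <;>
    obtain ⟨h1, hreg⟩ := hloc M
    · exact ringKrullDim_eq_one_of_isRegularIdeal hreg
    · exact isCohenMacaulayLocal_of_isRegularIdeal hreg
    · obtain ⟨c, -, hc⟩ := exists_sq_eq_span_singleton_mul hreg (hasymp M)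
        (Ideal.IsRegularIdeal.map_localization_atPrime hI M)
      exact ⟨c, hc⟩
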